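/- There is an absolute constant $C>0$ such that the following holds for all integers $D\ge 1$, $p_1,\dots,p_D\ge 1$ and $R\ge 1$. For a tensor $\mathbf A\in\mathbb R^{p_1\times\cdots\times p_D}$ let $\|\mathbf A\|_F=\big(\sum_{i_1,\dots,i_D}A_{i_1,\dots,i_D}^2\big)^{1/2}$ be its Frobenius norm, and let $\mathrm{rank}(\mathbf A)$ be its CP rank, that is, the smallest integer $S\ge 0$ such that $\mathbf A=\sum_{r=1}^{S}\boldsymbol\beta_{1,r}\circ\cdots\circ\boldsymbol\beta_{D,r}$ for some vectors $\boldsymbol\beta_{d,r}\in\mathbb R^{p_d}$, where $\circ$ is the outer product. Let $$\mathcal P=\{\mathbf A\in\mathbb R^{p_1\times\cdots\times p_D}:\ \|\mathbf A\|_F=1,\ \mathrm{rank}(\mathbf A)\le R\},$$ and let $w(\mathcal P)=\mathbb E\,\sup_{\mathbf A\in\mathcal P}\langle \mathrm{vec}(\mathbf A),\mathbf x\rangle$ with $\mathbf x\sim\mathcal N(\mathbf 0,\mathbf I_{\prod_d p_d})$ be its Gaussian width. Then the supremum is finite for every value of $\mathbf x$ and is an integrable function of $\mathbf x$, so that $w(\mathcal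 P)$ is well defined, and $$w(\mathcal P)\le C\Big(R^D+R\sum_{d=1}^D p_d\Big).$$ -/

import Mathlib

open MeasureTheory ProbabilityTheory

noncomputable section

namespace CPTensor

/-- Real tensors of order `D` with dimensions `p 0, …, p (D - 1)`: real arrays indexed by the
multi-indices `(i_1, …, i_D)`. The norm of this Euclidean space is the Frobenius norm and its inner
product is the entrywise one. -/
abbrev Tensor {D : ℕ} (p : Fin D → ℕ) : Type :=
  EuclideanSpace ℝ ((d : Fin D) → Fin (p d))

/-- The outer product `β_1 ∘ ⋯ ∘ β_D` of `D` vectors, with entries `∏ d, β_d (i_d)`. -/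
def outerProduct {D : ℕ} {p : Fin D → ℕ} (β : (d : Fin D) → Fin (p d) → ℝ) : Tensor p :=
  WithLp.toLp 2 fun i => ∏ d, β d (i d)

/-- `A` has a CP decomposition with `R` terms: `A = ∑_{r = 1}^R β_{1,r} ∘ ⋯ ∘ β_{D,r}`. -/
def HasCPDecomposition {D : ℕ} {p : Fin D → ℕ} (A : Tensor p) (R : ℕ) : Prop :=
  ∃ β : Fin R → (d : Fin D) → Fin (p d) → ℝ, A = ∑ r, outerProduct (β r)

/-- The CP rank of a tensor: the smallest `R` for which there is a CP decomposition with `R` terms.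
(It is finite whenever `D ≥ 1`; the value `⊤` stands for "no CP decomposition".) -/
def cpRank {D : ℕ} {p : Fin D → ℕ} (A : Tensor p) : ℕ∞ :=
  ⨅ (R : ℕ) (_ : HasCPDecomposition A R), (R : ℕ∞)

/-- The tensors of unit Frobenius norm whose CP rank is at most `R`. -/
def lowRankUnitTensors {D : ℕ} (p : Fin D → ℕ) (R : ℕ) : Set (Tensor p) :=
  {A | ‖A‖ = 1 ∧ cpRank A ≤ R}

/-- The supremum `sup_{A ∈ 𝒜} ⟨A, x⟩`. -/
def supInner {D : ℕ} {p : Fin D → ℕ} (𝒜 : Set (Tensor p)) (x : Tensor p) : ℝ :=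
  ⨆ A : 𝒜, inner ℝ (A : Tensor p) x

/-- The Gaussian width `E sup_{A ∈ 𝒜} ⟨A, x⟩`, where `x` is a standard Gaussian tensor, that is,
`x ∼ N(0, I)`. -/
def gaussianWidth {D : ℕ} {p : Fin D → ℕ} (𝒜 : Set (Tensor p)) : ℝ :=
  ∫ x, supInner 𝒜 x ∂(stdGaussian (Tensor p))

end CPTensor

end

/-! The vectors of a CP decomposition can be arbitrarily large and cancel, so the decomposition
itself is not discretized. In each mode they are expanded in an orthonormal basis of their span,
which turns `A` into a Tucker tensor. Its core entries are inner products of `A` with outer products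
of norm at most one, so all `N = R ^ D + R * ∑ d, p d` parameters lie in `[-1, 1]`
(`exists_tuckerTensor_of_mem`).

A grid on the parameters gives a `1 / n`-net, `n = ∏ d, p d`, of log-cardinality at most `N * (2 *
N)`. A soft-max bound (`integral_iSup_inner_le_of_cover`) at inverse temperature `N` then costs at
most `5 * N`, and the net error at most `(1 / n) * E‖x‖ ≤ 1 ≤ N`. -/

namespace CPTensor

/-! ### Gaussian suprema over subsets of the unit ball -/

section GaussianSup

variable {E : Type*} [NormedAddCommGroup E] [InnerProductSpace ℝ E]

lemma bddAbove_range_inner {𝒜 : Set E} (h𝒜 : ∀ A ∈ 𝒜, ‖A‖ ≤ 1) (x : E) :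
    BddAbove (Set.range fun A : 𝒜 => inner ℝ (A : E) x) := by
  refine ⟨‖x‖, ?_⟩
  rintro _ ⟨A, rfl⟩
  calc inner ℝ (A : E) x ≤ ‖(A : E)‖ * ‖x‖ := real_inner_le_norm _ _
    _ ≤ 1 * ‖x‖ := by gcongr; exact h𝒜 A A.2
    _ = ‖x‖ := one_mul _

/-- Continuity gives measurability of the supremum; comparison with its value at `0` gives the
integrable majorant `‖x‖`. -/
lemma lipschitzWith_iSup_inner {𝒜 : Set E} (h𝒜 : ∀ A ∈ 𝒜, ‖A‖ ≤ 1) :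
    LipschitzWith 1 fun x : E => ⨆ A : 𝒜, inner ℝ (A : E) x := by
  refine LipschitzWith.of_le_add_mul 1 fun x y => ?_
  rcases isEmpty_or_nonempty 𝒜 with h | h
  · simp
  · refine ciSup_le fun A => ?_
    have h1 : inner ℝ (A : E) y ≤ ⨆ A : 𝒜, inner ℝ (A : E) y :=
      le_ciSup (bddAbove_range_inner h𝒜 y) A
    have h2 : inner ℝ (A : E) (x - y) ≤ ‖(A : E)‖ * ‖x - y‖ := real_inner_le_norm _ _
    have h3 : ‖(A : E)‖ * ‖x - y‖ ≤ 1 * ‖x - y‖ := by gcongr; exact h𝒜 A A.2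
    rw [inner_sub_right] at h2
    rw [dist_eq_norm, NNReal.coe_one]
    linarith

lemma abs_iSup_inner_le {𝒜 : Set E} (h𝒜 : ∀ A ∈ 𝒜, ‖A‖ ≤ 1) (x : E) :
    |⨆ A : 𝒜, inner ℝ (A : E) x| ≤ ‖x‖ := by
  simpa [Real.dist_eq] using (lipschitzWith_iSup_inner h𝒜).dist_le_mul x 0

variable [FiniteDimensional ℝ E] [MeasurableSpace E] [BorelSpace E]

lemma integrable_iSup_inner {𝒜 : Set E} (h𝒜 : ∀ A ∈ 𝒜, ‖A‖ ≤ 1) :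
    Integrable (fun x : E => ⨆ A : 𝒜, inner ℝ (A : E) x) (stdGaussian E) :=
  Integrable.mono' (IsGaussian.integrable_id (μ := stdGaussian E)).norm
    (lipschitzWith_iSup_inner h𝒜).continuous.aestronglyMeasurable
    (ae_of_all _ fun x => abs_iSup_inner_le h𝒜 x)

lemma map_inner_stdGaussian (v : E) :
    (stdGaussian E).map (fun x => inner ℝ v x) = gaussianReal 0 (‖v‖ ^ 2).toNNReal := by
  have h := IsGaussian.map_eq_gaussianReal (μ := stdGaussian E) (innerSL ℝ v)
  rw [integral_strongDual_stdGaussian, variance_dual_stdGaussian, innerSL_apply_norm] at h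
  exact h

lemma integrable_exp_inner_stdGaussian (v : E) (t : ℝ) :
    Integrable (fun x => Real.exp (t * inner ℝ v x)) (stdGaussian E) := by
  have h := integrable_exp_mul_gaussianReal (μ := 0) (v := (‖v‖ ^ 2).toNNReal) t
  rw [← map_inner_stdGaussian] at h
  exact h.comp_measurable (by fun_prop)

lemma integral_exp_inner_stdGaussian (v : E) (t : ℝ) :
    ∫ x, Real.exp (t * inner ℝ v x) ∂(stdGaussian E) = Real.exp (‖v‖ ^ 2 * t ^ 2 / 2) := by
  have h := mgf_gaussianReal (map_inner_stdGaussian v) t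
  simpa [mgf] using h

lemma integral_inner_sq_stdGaussian (v : E) :
    ∫ x, inner ℝ v x ^ 2 ∂(stdGaussian E) = ‖v‖ ^ 2 := by
  have h := variance_dual_stdGaussian (innerSL ℝ v)
  rw [variance_of_integral_eq_zero (by fun_prop) (integral_strongDual_stdGaussian _),
    innerSL_apply_norm] at h
  exact h

lemma integral_norm_stdGaussian_le :
    ∫ x, ‖x‖ ∂(stdGaussian E) ≤ (1 + Module.finrank ℝ E) / 2 := by
  let b := stdOrthonormalBasis ℝ E
  have hint (i) : Integrable (fun x => inner ℝ (b i) x ^ 2) (stdGaussian E) :=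
    ((IsGaussian.memLp_dual (stdGaussian E) (innerSL ℝ (b i)) 2 (by simp))).integrable_sq
  have hsq : ∫ x, ‖x‖ ^ 2 ∂(stdGaussian E) = Module.finrank ℝ E := by
    simp_rw [← b.sum_sq_inner_right]
    rw [integral_finsetSum _ fun i _ => hint i]
    simp [integral_inner_sq_stdGaussian]
  have hsqi : Integrable (fun x => ‖x‖ ^ 2) (stdGaussian E) := by
    simp_rw [← b.sum_sq_inner_right]
    exact integrable_finsetSum _ fun i _ => hint i
  calc ∫ x, ‖x‖ ∂(stdGaussian E) ≤ ∫ x, (1 + ‖x‖ ^ 2) / 2 ∂(stdGaussian E) := by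
        refine integral_mono IsGaussian.integrable_id.norm
          (((integrable_const _).add hsqi).div_const 2) fun x => ?_
        change ‖x‖ ≤ (1 + ‖x‖ ^ 2) / 2
        nlinarith [sq_nonneg (‖x‖ - 1)]
    _ = _ := by
        rw [integral_div, integral_add (integrable_const _) hsqi, hsq]
        simp

/-- Soft-max bound for the Gaussian width of a set covered by finitely many balls of
radius `ε`. -/
lemma integral_iSup_inner_le_of_cover {𝒜 : Set E} (h𝒜 : ∀ A ∈ 𝒜, ‖A‖ ≤ 1) {T : Type*} [Fintype T]
    [Nonempty T] (f : T → E) {ε : ℝ} (hε0 : 0 ≤ ε) (hε : ε ≤ 1) (hcov : ∀ A ∈ 𝒜, ∃ t, ‖A - f t‖ ≤ ε)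
    {l : ℝ} (hl : 0 < l) :
    ∫ x, (⨆ A : 𝒜, inner ℝ (A : E) x) ∂(stdGaussian E) ≤
      (1 + Real.log (Fintype.card T) + 2 * l ^ 2) / l + ε * ∫ x, ‖x‖ ∂(stdGaussian E) := by
  classical
  rcases 𝒜.eq_empty_or_nonempty with rfl | ⟨A₀, hA₀⟩
  · simp only [Real.iSup_of_isEmpty, integral_zero]
    have h1 : 0 ≤ Real.log (Fintype.card T) := Real.log_natCast_nonneg _
    have h2 : 0 ≤ ∫ x, ‖x‖ ∂(stdGaussian E) := integral_nonneg fun _ => norm_nonneg _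
    positivity
  have : Nonempty 𝒜 := ⟨A₀, hA₀⟩
  -- No bound on `f` is assumed. Points of norm above `2` are farther than `ε ≤ 1` from `𝒜` and can
  -- be dropped, which bounds the exponential moments.
  set T' : Finset T := {t | ‖f t‖ ≤ 2} with hT'
  set c : ℝ := Fintype.card T * Real.exp (2 * l ^ 2) with hc
  have hcard : (0 : ℝ) < Fintype.card T := by exact_mod_cast Fintype.card_pos
  have hc0 : 0 < c := by positivity
  have hlogc : Real.log c = Real.log (Fintype.card T) + 2 * l ^ 2 := by
    rw [hc, Real.log_mul hcard.ne' (Real.exp_pos _).ne', Real.log_exp]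
  have hnorm : Integrable (fun x : E => ‖x‖) (stdGaussian E) := IsGaussian.integrable_id.norm
  have hsum : Integrable (fun x : E => ∑ t ∈ T', Real.exp (l * inner ℝ (f t) x))
      (stdGaussian E) := integrable_finsetSum _ fun t _ => integrable_exp_inner_stdGaussian _ _
  have hpt (x : E) : (⨆ A : 𝒜, inner ℝ (A : E) x) ≤
      ((∑ t ∈ T', Real.exp (l * inner ℝ (f t) x)) / c + Real.log c) / l + ε * ‖x‖ := by
    refine ciSup_le fun A => ?_
    obtain ⟨t, ht⟩ := hcov A A.2
    have htT : t ∈ T' := by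
      have h1 : ‖f t‖ ≤ ‖(A : E)‖ + ‖(A : E) - f t‖ := norm_le_norm_add_norm_sub _ _
      have h2 := h𝒜 A A.2
      simp only [hT', Finset.mem_filter, Finset.mem_univ, true_and]
      linarith
    have h1 : inner ℝ ((A : E) - f t) x ≤ ε * ‖x‖ :=
      (real_inner_le_norm _ _).trans (by gcongr)
    have h2 : Real.exp (l * inner ℝ (f t) x) ≤ ∑ t ∈ T', Real.exp (l * inner ℝ (f t) x) :=
      Finset.single_le_sum (f := fun t => Real.exp (l * inner ℝ (f t) x))
        (fun _ _ => (Real.exp_pos _).le) htT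
    -- The tangent-line inequality `y + 1 ≤ exp y` replaces Jensen for the logarithm; `c` bounds the
    -- expected sum of exponentials.
    have h3 : l * inner ℝ (f t) x - Real.log c ≤ Real.exp (l * inner ℝ (f t) x) / c := by
      have h := Real.add_one_le_exp (l * inner ℝ (f t) x - Real.log c)
      rw [Real.exp_sub, Real.exp_log hc0] at h
      linarith
    have h4 : inner ℝ (f t) x ≤
        ((∑ t ∈ T', Real.exp (l * inner ℝ (f t) x)) / c + Real.log c) / l := by
      rw [le_div_iff₀ hl]
      have := div_le_div_of_nonneg_right h2 hc0.le
      linarith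
    rw [inner_sub_left] at h1
    linarith
  have hS : (∫ x, ∑ t ∈ T', Real.exp (l * inner ℝ (f t) x) ∂(stdGaussian E)) / c ≤ 1 := by
    rw [div_le_one hc0, integral_finsetSum _ fun t _ => integrable_exp_inner_stdGaussian _ _, hc]
    calc _ ≤ ∑ t ∈ T', Real.exp (2 * l ^ 2) := by
          refine Finset.sum_le_sum fun t ht => ?_
          rw [integral_exp_inner_stdGaussian]
          have h2 : ‖f t‖ ≤ 2 := by simpa [hT'] using ht
          have h4 : ‖f t‖ ^ 2 ≤ 4 := by nlinarith [norm_nonneg (f t)]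
          gcongr
          nlinarith [sq_nonneg l]
      _ = T'.card * Real.exp (2 * l ^ 2) := by simp
      _ ≤ _ := by gcongr; exact T'.card_le_univ
  have hmid : Integrable (fun x : E =>
      ((∑ t ∈ T', Real.exp (l * inner ℝ (f t) x)) / c + Real.log c) / l) (stdGaussian E) :=
    ((hsum.div_const c).add (integrable_const _)).div_const l
  calc _ ≤ ∫ x, (((∑ t ∈ T', Real.exp (l * inner ℝ (f t) x)) / c + Real.log c) / l + ε * ‖x‖)
        ∂(stdGaussian E) := by
        refine integral_mono (integrable_iSup_inner h𝒜) ?_ hpt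
        exact hmid.add (hnorm.const_mul ε)
    _ = ((∫ x, ∑ t ∈ T', Real.exp (l * inner ℝ (f t) x) ∂(stdGaussian E)) / c + Real.log c) / l
        + ε * ∫ x, ‖x‖ ∂(stdGaussian E) := by
        rw [integral_add hmid (hnorm.const_mul ε), integral_div, integral_add (hsum.div_const c) (integrable_const _),
          integral_div, integral_const_mul]
        simp
    _ ≤ _ := by
        rw [hlogc]
        have : (∫ x, ∑ t ∈ T', Real.exp (l * inner ℝ (f t) x) ∂(stdGaussian E)) / c +
            (Real.log (Fintype.card T) + 2 * l ^ 2) ≤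
            1 + Real.log (Fintype.card T) + 2 * l ^ 2 := by linarith
        gcongr

end GaussianSup

/-! ### Bounded Tucker parametrization and its stability -/

section Tucker

/-- Any family of at most `R` vectors is reproduced by `R` vectors of norm at most one. -/
lemma exists_contracting_frame {E : Type*} [NormedAddCommGroup E] [InnerProductSpace ℝ E]
    {S R : ℕ} (hSR : S ≤ R) (v : Fin S → E) :
    ∃ u : Fin R → E, (∀ s, ‖u s‖ ≤ 1) ∧ ∀ r, v r = ∑ s, inner ℝ (u s) (v r) • u s := by
  let V := Submodule.span ℝ (Set.range v)
  have : FiniteDimensional ℝ V := FiniteDimensional.span_of_finite ℝ (Set.finite_range v)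
  let b := stdOrthonormalBasis ℝ V
  have hd : Module.finrank ℝ V ≤ R := by
    exact (finrank_range_le_card (R := ℝ) v).trans (by simpa using hSR)
  -- An orthonormal basis of the span, padded with zeros up to `R` vectors.
  refine ⟨fun s => if h : (s : ℕ) < Module.finrank ℝ V then (b ⟨s, h⟩ : E) else 0, ?_, ?_⟩
  · intro s
    dsimp only
    split_ifs with h
    · exact (b.norm_eq_one ⟨s, h⟩).le
    · simp
  · intro r
    have hr : v r ∈ V := Submodule.subset_span ⟨r, rfl⟩
    have h := congrArg (Subtype.val : V → E) (b.sum_repr' ⟨v r, hr⟩)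
    rw [← Finset.sum_subset (Finset.subset_univ
      (Finset.univ.map (Fin.castLEEmb hd))), Finset.sum_map]
    · simpa using h.symm
    · intro s _ hs
      have : ¬ (s : ℕ) < Module.finrank ℝ V := fun h => hs (by
        simp only [Finset.mem_map, Finset.mem_univ, true_and]
        exact ⟨⟨s, h⟩, rfl⟩)
      simp [this]

variable {D : ℕ} {p : Fin D → ℕ}

lemma inner_outerProduct (β γ : (d : Fin D) → EuclideanSpace ℝ (Fin (p d))) :
    inner ℝ (outerProduct fun d => β d) (outerProduct fun d => γ d) =
      ∏ d, inner ℝ (β d) (γ d) := by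
  simp only [outerProduct, PiLp.inner_apply, Finset.prod_univ_sum, Fintype.piFinset_univ]
  refine Finset.sum_congr rfl fun i _ => ?_
  simp [Finset.prod_mul_distrib]

lemma norm_outerProduct (β : (d : Fin D) → EuclideanSpace ℝ (Fin (p d))) :
    ‖outerProduct fun d => β d‖ = ∏ d, ‖β d‖ := by
  have h := inner_outerProduct β β
  simp only [real_inner_self_eq_norm_sq, Finset.prod_pow] at h
  exact (sq_eq_sq₀ (norm_nonneg _) (Finset.prod_nonneg fun _ _ => norm_nonneg _)).1 h

/-- The tensor with core `G` and factors `u`: `∑ s, G s • u_{1, s 1} ∘ ⋯ ∘ u_{D, s D}`. -/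
noncomputable def tuckerTensor {R : ℕ} (G : (Fin D → Fin R) → ℝ) (u : (d : Fin D) → Fin R → Fin (p d) → ℝ) :
    Tensor p :=
  WithLp.toLp 2 fun i => ∑ s : Fin D → Fin R, G s * ∏ d, u d (s d) (i d)

lemma exists_hasCPDecomposition_of_cpRank_le {A : Tensor p} {R : ℕ} (h : cpRank A ≤ R) :
    ∃ S ≤ R, HasCPDecomposition A S := by
  by_contra! hS
  have : ((R + 1 : ℕ) : ℕ∞) ≤ cpRank A := by
    refine le_iInf₂ fun S hA => ?_
    exact_mod_cast Nat.succ_le_of_lt (not_le.1 fun hle => hS S hle hA)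
  exact absurd (this.trans h) (not_le.2 (by exact_mod_cast Nat.lt_succ_self R))

/-- A unit tensor of CP rank at most `R` is a Tucker tensor with parameters in `[-1, 1]`. -/
lemma exists_tuckerTensor_of_mem {R : ℕ} {A : Tensor p} (hA : A ∈ lowRankUnitTensors p R) :
    ∃ (G : (Fin D → Fin R) → ℝ) (u : (d : Fin D) → Fin R → Fin (p d) → ℝ),
      (∀ s, |G s| ≤ 1) ∧ (∀ d s j, |u d s j| ≤ 1) ∧ A = tuckerTensor G u := by
  obtain ⟨hA1, hAR⟩ := hA
  obtain ⟨S, hSR, β, hβ⟩ := exists_hasCPDecomposition_of_cpRank_le hAR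
  let b (d : Fin D) (r : Fin S) : EuclideanSpace ℝ (Fin (p d)) := WithLp.toLp 2 (β r d)
  choose u hu hrep using fun d => exists_contracting_frame hSR (b d)
  have hG (s : Fin D → Fin R) : inner ℝ (outerProduct fun d => u d (s d)) A =
      ∑ r, ∏ d, inner ℝ (u d (s d)) (b d r) := by
    rw [hβ, inner_sum]
    exact Finset.sum_congr rfl fun r _ => inner_outerProduct (fun d => u d (s d)) fun d => b d r
  refine ⟨fun s => inner ℝ (outerProduct fun d => u d (s d)) A, fun d s j => u d s j, ?_, ?_, ?_⟩
  · intro s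
    refine (abs_real_inner_le_norm _ _).trans ?_
    rw [norm_outerProduct, hA1, mul_one]
    exact Finset.prod_le_one (fun _ _ => norm_nonneg _) fun d _ => hu d (s d)
  · intro d s j
    exact (PiLp.norm_apply_le (u d s) j).trans (hu d s)
  · ext i
    simp only [tuckerTensor, hG, Finset.sum_mul]
    rw [Finset.sum_comm, hβ]
    simp only [outerProduct, WithLp.ofLp_sum, Finset.sum_apply]
    refine Finset.sum_congr rfl fun r _ => ?_
    have hd (d : Fin D) : β r d (i d) = ∑ s, inner ℝ (u d s) (b d r) * u d s (i d) := by
      have h := congrArg (fun w : EuclideanSpace ℝ (Fin (p d)) => w (i d)) (hrep d r)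
      simpa [b] using h
    simp only [hd, Finset.prod_univ_sum, Fintype.piFinset_univ, Finset.prod_mul_distrib]

lemma abs_prod_sub_prod_le {ι : Type*} (t : Finset ι) {a b : ι → ℝ} {η : ℝ}
    (ha : ∀ i, |a i| ≤ 1) (hb : ∀ i, |b i| ≤ 1) (hab : ∀ i, |a i - b i| ≤ η) :
    |∏ i ∈ t, a i - ∏ i ∈ t, b i| ≤ t.card * η := by
  classical
  induction t using Finset.induction_on with
  | empty => simp
  | insert i t hi ih =>
    rw [Finset.prod_insert hi, Finset.prod_insert hi, Finset.card_insert_of_notMem hi]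
    have hpb : |∏ j ∈ t, b j| ≤ 1 := by
      rw [Finset.abs_prod]
      exact Finset.prod_le_one (fun _ _ => abs_nonneg _) fun j _ => hb j
    -- Telescoping: one factor is replaced at a time.
    have heq : a i * ∏ j ∈ t, a j - b i * ∏ j ∈ t, b j =
        a i * (∏ j ∈ t, a j - ∏ j ∈ t, b j) + (a i - b i) * ∏ j ∈ t, b j := by ring
    rw [heq]
    calc _ ≤ |a i| * |∏ j ∈ t, a j - ∏ j ∈ t, b j| + |a i - b i| * |∏ j ∈ t, b j| := by
          rw [← abs_mul, ← abs_mul]; exact abs_add_le _ _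
      _ ≤ 1 * (t.card * η) + η * 1 :=
          add_le_add (mul_le_mul (ha i) ih (abs_nonneg _) zero_le_one)
            (mul_le_mul (hab i) hpb (abs_nonneg _) ((abs_nonneg _).trans (hab i)))
      _ = _ := by push_cast; ring

lemma norm_tuckerTensor_sub_le {R : ℕ} {G G' : (Fin D → Fin R) → ℝ}
    {u u' : (d : Fin D) → Fin R → Fin (p d) → ℝ} {η : ℝ} (hη : 0 ≤ η)
    (hG' : ∀ s, |G' s| ≤ 1) (hu : ∀ d s j, |u d s j| ≤ 1) (hu' : ∀ d s j, |u' d s j| ≤ 1)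
    (hGG : ∀ s, |G s - G' s| ≤ η) (huu : ∀ d s j, |u d s j - u' d s j| ≤ η) :
    ‖tuckerTensor G u - tuckerTensor G' u'‖ ≤ (∏ d, p d : ℕ) * ((R : ℝ) ^ D * ((D + 1) * η)) := by
  set δ := (R : ℝ) ^ D * ((D + 1) * η) with hδ
  have hδ0 : 0 ≤ δ := by positivity
  have hentry (i : (d : Fin D) → Fin (p d)) :
      ‖(tuckerTensor G u - tuckerTensor G' u') i‖ ≤ δ := by
    simp only [tuckerTensor, PiLp.sub_apply, ← Finset.sum_sub_distrib]
    refine (norm_sum_le _ _).trans ?_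
    calc _ ≤ ∑ s : Fin D → Fin R, (D + 1) * η := by
          refine Finset.sum_le_sum fun s _ => ?_
          have h1 : |∏ d, u d (s d) (i d)| ≤ 1 := by
            rw [Finset.abs_prod]
            exact Finset.prod_le_one (fun _ _ => abs_nonneg _) fun d _ => hu _ _ _
          have h2 : |∏ d, u d (s d) (i d) - ∏ d, u' d (s d) (i d)| ≤ D * η := by
            simpa using abs_prod_sub_prod_le Finset.univ (fun d => hu d (s d) (i d))
              (fun d => hu' d (s d) (i d)) (fun d => huu d (s d) (i d))
          have heq : G s * ∏ d, u d (s d) (i d) - G' s * ∏ d, u' d (s d) (i d) =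
              (G s - G' s) * ∏ d, u d (s d) (i d) +
                G' s * (∏ d, u d (s d) (i d) - ∏ d, u' d (s d) (i d)) := by ring
          rw [heq, Real.norm_eq_abs]
          calc _ ≤ |G s - G' s| * |∏ d, u d (s d) (i d)| +
                |G' s| * |∏ d, u d (s d) (i d) - ∏ d, u' d (s d) (i d)| := by
                rw [← abs_mul, ← abs_mul]; exact abs_add_le _ _
            _ ≤ η * 1 + 1 * (D * η) :=
                add_le_add (mul_le_mul (hGG s) h1 (abs_nonneg _) hη)
                  (mul_le_mul (hG' s) h2 (abs_nonneg _) zero_le_one)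
            _ = _ := by ring
      _ = δ := by simp [hδ]
  have hn : ((∏ d, p d : ℕ) : ℝ) ≤ ((∏ d, p d : ℕ) : ℝ) ^ 2 := by
    exact_mod_cast Nat.le_self_pow two_ne_zero _
  refine le_of_sq_le_sq ?_ (by positivity)
  rw [EuclideanSpace.norm_sq_eq]
  calc _ ≤ ∑ _i : (d : Fin D) → Fin (p d), δ ^ 2 :=
        Finset.sum_le_sum fun i _ => pow_le_pow_left₀ (norm_nonneg _) (hentry i) 2
    _ = (∏ d, p d : ℕ) * δ ^ 2 := by simp
    _ ≤ _ := by rw [mul_pow _ δ]; exact mul_le_mul_of_nonneg_right hn (sq_nonneg δ)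

end Tucker

/-! ### Discretization of `[-1, 1]` -/

section Grid

/-- The `j`-th point of the grid of mesh `1 / m` in `[-1, 1]`. -/
noncomputable def gridPoint (m : ℕ) (j : Fin (2 * m + 1)) : ℝ := ((j : ℝ) - m) / m

lemma abs_gridPoint_le {m : ℕ} (hm : 0 < m) (j : Fin (2 * m + 1)) : |gridPoint m j| ≤ 1 := by
  have hm' : (0 : ℝ) < m := by exact_mod_cast hm
  have hj : (j : ℝ) ≤ 2 * m := by exact_mod_cast Nat.lt_succ_iff.1 j.2
  have hj0 : (0 : ℝ) ≤ (j : ℕ) := Nat.cast_nonneg _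
  rw [gridPoint, abs_div, abs_of_pos hm', div_le_one hm', abs_le]
  constructor <;> linarith

lemma exists_gridPoint_near {m : ℕ} (hm : 0 < m) {a : ℝ} (ha : |a| ≤ 1) :
    ∃ j, |a - gridPoint m j| ≤ 1 / m := by
  have hm' : (0 : ℝ) < m := by exact_mod_cast hm
  obtain ⟨h1, h2⟩ := abs_le.1 ha
  have h0 : 0 ≤ (a + 1) * m := mul_nonneg (by linarith) hm'.le
  have hlt : ⌊(a + 1) * m⌋₊ < 2 * m + 1 := by
    rw [Nat.lt_succ_iff]
    refine Nat.floor_le_of_le ?_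
    push_cast
    exact mul_le_mul_of_nonneg_right (by linarith) hm'.le
  refine ⟨⟨_, hlt⟩, ?_⟩
  have hf1 := Nat.floor_le h0
  have hf2 := Nat.lt_floor_add_one ((a + 1) * m)
  have heq : a - gridPoint m ⟨_, hlt⟩ = ((a + 1) * m - ⌊(a + 1) * m⌋₊) / m := by
    rw [gridPoint]; field_simp; ring
  rw [heq, abs_div, abs_of_pos hm', abs_of_nonneg (by linarith)]
  exact div_le_div_of_nonneg_right (by linarith) hm'.le

end Grid

/-! ### Entropy count and the width bound -/

section Width

variable {D : ℕ} {p : Fin D → ℕ} {R : ℕ}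

/-- Each logarithm is bounded by `log t ≤ t - 1`. The `-2 * D` coming from `2 * log n` absorbs `log
(D + 1) ≤ D` and, as `D ≥ 1`, the remaining constant. -/
lemma log_card_grid_le (hD : 1 ≤ D) (hp : ∀ d, 1 ≤ p d) (hR : 1 ≤ R) :
    Real.log ((2 * ((∏ d, p d) ^ 2 * R ^ D * (D + 1)) + 1 : ℕ) : ℝ) ≤
      2 * ((R : ℝ) ^ D + (R : ℝ) * ∑ d, (p d : ℝ)) := by
  have hn0 : 0 < ∏ d, p d := Finset.prod_pos fun d _ => hp d
  have hn : (0 : ℝ) < (∏ d, p d : ℕ) := by exact_mod_cast hn0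
  have hRD : (0 : ℝ) < (R : ℝ) ^ D := by positivity
  have hD1 : (0 : ℝ) < (D : ℝ) + 1 := by positivity
  have hle : ((2 * ((∏ d, p d) ^ 2 * R ^ D * (D + 1)) + 1 : ℕ) : ℝ) ≤
      3 * (((∏ d, p d : ℕ) : ℝ) ^ 2 * (R : ℝ) ^ D * (D + 1)) := by
    have : 0 < (∏ d, p d) ^ 2 * R ^ D * (D + 1) := by positivity
    exact_mod_cast (by omega : 2 * ((∏ d, p d) ^ 2 * R ^ D * (D + 1)) + 1 ≤
      3 * ((∏ d, p d) ^ 2 * R ^ D * (D + 1)))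
  have hlogn : Real.log (∏ d, p d : ℕ) ≤ ∑ d, (p d : ℝ) - D := by
    rw [Nat.cast_prod, Real.log_prod fun d _ => by have := hp d; positivity]
    calc _ ≤ ∑ d, ((p d : ℝ) - 1) := Finset.sum_le_sum fun d _ =>
          Real.log_le_sub_one_of_pos (by exact_mod_cast hp d)
      _ = _ := by simp
  have h3 := Real.log_le_sub_one_of_pos (show (0 : ℝ) < 3 by norm_num)
  have hlogR := Real.log_le_sub_one_of_pos hRD
  have hlogD := Real.log_le_sub_one_of_pos hD1
  have hD' : (1 : ℝ) ≤ D := by exact_mod_cast hD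
  have hS : (∑ d, (p d : ℝ)) ≤ R * ∑ d, (p d : ℝ) :=
    le_mul_of_one_le_left (by positivity) (by exact_mod_cast hR)
  refine (Real.log_le_log (by positivity) hle).trans ?_
  rw [Real.log_mul (by positivity) (by positivity), Real.log_mul (by positivity) (by positivity),
    Real.log_mul (by positivity) (by positivity), Real.log_pow]
  push_cast
  push_cast at hlogn
  linarith

lemma gaussianWidth_lowRankUnitTensors_le (hD : 1 ≤ D) (hp : ∀ d, 1 ≤ p d) (hR : 1 ≤ R) :
    gaussianWidth (lowRankUnitTensors p R) ≤ 6 * ((R : ℝ) ^ D + (R : ℝ) * ∑ d, (p d : ℝ)) := by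
  set N : ℝ := (R : ℝ) ^ D + (R : ℝ) * ∑ d, (p d : ℝ) with hN
  set n : ℕ := ∏ d, p d with hn
  -- Chosen so that the perturbation bound `n * R ^ D * (D + 1) / m` equals `1 / n`.
  set m : ℕ := n ^ 2 * R ^ D * (D + 1) with hm
  have hn0 : 0 < n := Finset.prod_pos fun d _ => hp d
  have hm0 : 0 < m := by positivity
  have hn1 : (1 : ℝ) ≤ n := by exact_mod_cast hn0
  have hN1 : 1 ≤ N := by
    have h1 : (1 : ℝ) ≤ (R : ℝ) ^ D := one_le_pow₀ (by exact_mod_cast hR)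
    have h2 : (0 : ℝ) ≤ (R : ℝ) * ∑ d, (p d : ℝ) := by positivity
    linarith
  let T := ((Fin D → Fin R) → Fin (2 * m + 1)) ×
    ((d : Fin D) → Fin R → Fin (p d) → Fin (2 * m + 1))
  let f (t : T) : Tensor p := tuckerTensor (fun s => gridPoint m (t.1 s))
    fun d s j => gridPoint m (t.2 d s j)
  have hcov (A : Tensor p) (hA : A ∈ lowRankUnitTensors p R) : ∃ t : T, ‖A - f t‖ ≤ 1 / n := by
    obtain ⟨G, u, hG, hu, rfl⟩ := exists_tuckerTensor_of_mem hA
    choose g hg using fun s => exists_gridPoint_near hm0 (hG s)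
    choose w hw using fun d s j => exists_gridPoint_near hm0 (hu d s j)
    refine ⟨(g, w), (norm_tuckerTensor_sub_le (η := 1 / m) (by positivity)
      (fun s => abs_gridPoint_le hm0 _) hu (fun d s j => abs_gridPoint_le hm0 _) hg hw).trans ?_⟩
    have hR0 : (R : ℝ) ≠ 0 := by positivity
    have hn0' : (n : ℝ) ≠ 0 := by positivity
    rw [← hn, hm]
    push_cast
    apply le_of_eq
    field_simp
  have hcard : Real.log (Fintype.card T) ≤ N * (2 * N) := by
    have : Fintype.card T = (2 * m + 1) ^ (R ^ D + R * ∑ d, p d) := by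
      simp only [T, Fintype.card_prod, Fintype.card_fun, Fintype.card_pi, Fintype.card_fin]
      rw [pow_add, Finset.mul_sum, ← Finset.prod_pow_eq_pow_sum]
      simp only [← pow_mul, mul_comm]
    rw [this, Nat.cast_pow, Real.log_pow]
    have hcast : ((R ^ D + R * ∑ d, p d : ℕ) : ℝ) = N := by rw [hN]; push_cast; rfl
    rw [hcast]
    exact mul_le_mul_of_nonneg_left (log_card_grid_le hD hp hR) (by linarith)
  have hnorm : ∫ x, ‖x‖ ∂(stdGaussian (Tensor p)) ≤ n := by
    refine integral_norm_stdGaussian_le.trans ?_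
    have : (Module.finrank ℝ (Tensor p) : ℝ) = n := by simp [hn]
    rw [this]
    linarith
  have hle : (1 / n : ℝ) ≤ 1 := by rw [div_le_one (by positivity)]; exact hn1
  have hw := integral_iSup_inner_le_of_cover (𝒜 := lowRankUnitTensors p R)
    (fun A hA => hA.1.le) f (by positivity) hle hcov (l := N) (by linarith)
  have h1 : (1 / n : ℝ) * ∫ x, ‖x‖ ∂(stdGaussian (Tensor p)) ≤ 1 := by
    calc _ ≤ (1 / n : ℝ) * n := by gcongr
      _ = 1 := by field_simp
  have h2 : (1 + Real.log (Fintype.card T) + 2 * N ^ 2) / N ≤ 5 * N := by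
    rw [div_le_iff₀ (by linarith)]
    nlinarith
  calc gaussianWidth (lowRankUnitTensors p R) ≤ _ := hw
    _ ≤ 5 * N + 1 := add_le_add h2 h1
    _ ≤ 6 * N := by linarith

end Width

end CPTensor

theorem theorem4 :
    ∃ C : ℝ, 0 < C ∧
      ∀ (D : ℕ) (p : Fin D → ℕ) (R : ℕ), 1 ≤ D → (∀ d, 1 ≤ p d) → 1 ≤ R →
        (∀ x : CPTensor.Tensor p,
          BddAbove ((fun A => inner ℝ A x) '' CPTensor.lowRankUnitTensors p R)) ∧
        Integrable (CPTensor.supInner (CPTensor.lowRankUnitTensors p R))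
          (stdGaussian (CPTensor.Tensor p)) ∧
        CPTensor.gaussianWidth (CPTensor.lowRankUnitTensors p R) ≤
          C * ((R : ℝ) ^ D + (R : ℝ) * ∑ d, (p d : ℝ)) := by
  refine ⟨6, by norm_num, fun D p R hD hp hR => ⟨fun x => ?_, ?_, ?_⟩⟩
  · rw [Set.image_eq_range]
    exact CPTensor.bddAbove_range_inner (fun A hA => hA.1.le) x
  · exact CPTensor.integrable_iSup_inner fun A hA => hA.1.le
  · exact CPTensor.gaussianWidth_lowRankUnitTensors_le hD hp hR
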